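/- Let $k$ be a field, $R=k[x_1,\dots,x_r]$, and let $I$ be a monomial ideal of $R$, i.e. an ideal generated by monomials. If $R/I$ is Cohen–Macaulay, then $R/\sqrt I$ is also Cohen–Macaulay. (A Noetherian ring $A$ is Cohen–Macaulay if $\operatorname{depth} A_{\mathfrak m}=\dim A_{\mathfrak m}$ for every maximal ideal $\mathfrak m$ of $A$; the zero ring counts as Cohen–Macaulay.) -/

import Mathlib

open MvPolynomial

/-- The depth of a local ring `A`: the supremum of the lengths of the `A`-regular sequences
contained in the maximal ideal. -/
noncomputable def localRingDepth (A : Type*) [CommRing A] [IsLocalRing A] : ℕ∞ :=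
  ⨆ (rs : List A) (_ : RingTheory.Sequence.IsRegular A rs)
    (_ : ∀ r ∈ rs, r ∈ IsLocalRing.maximalIdeal A), (rs.length : ℕ∞)

/-- A Noetherian local ring is Cohen-Macaulay if its depth equals its Krull dimension. -/
structure IsCohenMacaulayLocalRing (A : Type*) [CommRing A] [IsLocalRing A] : Prop where
  isNoetherianRing : IsNoetherianRing A
  depth_eq_dim : (localRingDepth A : WithBot ℕ∞) = ringKrullDim A

/-- A Noetherian ring is Cohen-Macaulay if all of its localizations at maximal ideals are
Cohen-Macaulay local rings. (The zero ring satisfies this vacuously.) -/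
structure IsCohenMacaulayRing (A : Type*) [CommRing A] : Prop where
  isNoetherianRing : IsNoetherianRing A
  localization_maximal : ∀ (m : Ideal A) [m.IsMaximal],
    IsCohenMacaulayLocalRing (Localization.AtPrime m)

/-- An ideal of a polynomial ring is monomial if it is generated by monomials
(the monomial `x ^ a` has coefficient one). -/
def IsMonomialIdeal {σ k : Type*} [CommSemiring k] (I : Ideal (MvPolynomial σ k)) : Prop :=
  ∃ S : Set (σ →₀ ℕ), I = Ideal.span ((fun a => monomial a (1 : k)) '' S)

/-! ### Descent of Cohen–Macaulayness along split integral extensions with going-down. -/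

section Retract

open CategoryTheory Abelian RingTheory.Sequence IsLocalRing

universe u

/-! Put A = R/√I and B = R/I. For suitable N > 0 the substitution x_i ↦ x_i^N carries √I into I, so
it makes B an integral A-algebra. Keeping only the exponents divisible by N, and dividing them by N,
gives an A-linear retraction B → A. Going-down holds because R is a normal domain, integral over its
image, and it passes to the quotients.

`IsCohenMacaulayRing.of_retraction` then descends the property: for m maximal in A, elements of m
are chosen one at a time to form a B-regular sequence of length ht m. The retraction makes it
A-regular, so depth A_m ≥ dim A_m. -/

/-- Dimension shifting: Ext^i(N, M/aM) sits between Ext^i(N, M) and Ext^(i+1)(N, M), so each element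
of `rs` uses up one vanishing degree. -/
lemma subsingleton_linearMap_quotient_of_subsingleton_ext {S : Type u} [CommRing S]
    (N : ModuleCat.{u} S) (rs : List S) (M : ModuleCat.{u} S)
    (h : ∀ i ≤ rs.length, Subsingleton (Ext N M i)) (reg : IsWeaklyRegular M rs) :
    Subsingleton (N →ₗ[S] M ⧸ (Ideal.ofList rs • ⊤ : Submodule S M)) := by
  induction rs generalizing M with
  | nil =>
    have : Subsingleton (N →ₗ[S] M) :=
      (Ext.addEquiv₀.trans ModuleCat.homAddEquiv).symm.toEquiv.subsingleton_congr.mpr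
        (h 0 (Nat.zero_le _))
    have e : (Ideal.ofList ([] : List S) • ⊤ : Submodule S M) = ⊥ := by simp
    exact ((Submodule.quotEquivOfEqBot _ e).congrRight (M := N)).toEquiv.subsingleton
  | cons a rs ih =>
    rw [isWeaklyRegular_cons_iff] at reg
    have := ih (ModuleCat.of S (QuotSMulTop a M)) (fun i hi ↦ by
      have zero1 := AddCommGrpCat.isZero_of_iff_subsingleton.mpr
        (h i (hi.trans (Nat.le_succ _)))
      have zero2 := AddCommGrpCat.isZero_of_iff_subsingleton.mpr
        (h (i + 1) (Nat.succ_le_succ hi))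
      exact AddCommGrpCat.subsingleton_of_isZero <| ShortComplex.Exact.isZero_of_both_zeros
        ((Ext.covariant_sequence_exact₃' N reg.1.smulShortComplex_shortExact) i (i + 1) rfl)
        (zero1.eq_zero_of_src _) (zero2.eq_zero_of_tgt _)) reg.2
    exact ((Submodule.quotOfListConsSMulTopEquivQuotSMulTopInner M a rs).congrRight
      (M := N)).toEquiv.subsingleton_congr.mpr this

/-- In a Noetherian local ring, a weakly regular sequence shorter than the depth does not make the
maximal ideal associated to the quotient. -/
lemma maximalIdeal_notMem_associatedPrimes_of_length_lt_depth {S : Type u} [CommRing S]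
    [IsLocalRing S] [IsNoetherianRing S] (rs : List S) (reg : IsWeaklyRegular S rs)
    (hlt : (rs.length : ℕ∞) < localRingDepth S) :
    maximalIdeal S ∉ associatedPrimes S (S ⧸ (Ideal.ofList rs • ⊤ : Submodule S S)) := by
  obtain ⟨l, hl, hlm, hlen⟩ : ∃ l : List S, IsRegular S l ∧
      (∀ r ∈ l, r ∈ maximalIdeal S) ∧ rs.length < l.length := by
    simpa only [localRingDepth, lt_iSup_iff, exists_prop, Nat.cast_lt] using hlt
  -- Rees: the longer regular sequence `l` kills Ext of the residue field below degree `l.length`.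
  have hext := ModuleCat.subsingleton_ext_of_exists_isRegular (maximalIdeal S)
    (ModuleCat.of S (S ⧸ maximalIdeal S))
    (by rw [Module.support_eq_zeroLocus, Ideal.annihilator_quotient]) (ModuleCat.of S S)
    (by
      have : (maximalIdeal S • ⊤ : Submodule S S) = maximalIdeal S := by simp
      change (maximalIdeal S • ⊤ : Submodule S S) < ⊤
      rw [this]
      exact (Ideal.IsPrime.ne_top inferInstance).lt_top) l hlm hl
  have hsub := subsingleton_linearMap_quotient_of_subsingleton_ext
    (ModuleCat.of S (S ⧸ maximalIdeal S)) rs (ModuleCat.of S S)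
    (fun i hi ↦ hext i (hi.trans_lt hlen)) reg
  intro hass
  obtain ⟨-, x, hx⟩ := isAssociatedPrime_iff.mp hass
  let f : S →ₗ[S] S ⧸ (Ideal.ofList rs • ⊤ : Submodule S S) := LinearMap.toSpanSingleton S _ x
  have hf : maximalIdeal S ≤ LinearMap.ker f := by
    intro r hr
    rw [hx, Submodule.mem_colon_singleton] at hr
    simpa [f] using hr
  have h0 : Submodule.liftQ (maximalIdeal S) f hf = 0 := Subsingleton.elim (α := _ →ₗ[S] _) _ _
  have hx0 : x = 0 := by
    have h1 : f 1 = 0 := LinearMap.congr_fun h0 (Submodule.Quotient.mk 1)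
    simpa only [f, LinearMap.toSpanSingleton_apply, one_smul] using h1
  have hone : (1 : S) ∈ maximalIdeal S := by
    rw [hx, Submodule.mem_colon_singleton, hx0]
    simp
  exact (Ideal.ne_top_iff_one _).mp (Ideal.IsPrime.ne_top inferInstance) hone

/-- Weakly regular sequences on a module are weakly regular on its direct summands. -/
lemma RingTheory.Sequence.IsWeaklyRegular.of_leftInverse {A M M' : Type*} [CommRing A]
    [AddCommGroup M] [AddCommGroup M'] [Module A M] [Module A M'] (f : M' →ₗ[A] M)
    (g : M →ₗ[A] M') (hgf : g ∘ₗ f = LinearMap.id) {rs : List A} (reg : IsWeaklyRegular M rs) :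
    IsWeaklyRegular M' rs := by
  induction rs generalizing M M' with
  | nil => simp
  | cons a rs ih =>
    rw [isWeaklyRegular_cons_iff] at reg ⊢
    refine ⟨?_, ih (QuotSMulTop.map a f) (QuotSMulTop.map a g) ?_ reg.2⟩
    · have hf : Function.Injective f := fun x y h ↦ by
        simpa using (LinearMap.congr_fun hgf x).symm.trans
          ((congrArg g h).trans (LinearMap.congr_fun hgf y))
      exact reg.1.of_injective f hf
    · rw [← QuotSMulTop.map_comp, hgf, QuotSMulTop.map_id]

variable {A B : Type*} [CommRing A] [CommRing B] [Algebra A B]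

/-- For `A → B` integral with going-down and `B` Cohen-Macaulay, a weakly `B`-regular sequence of
elements of `A` of length less than the height of a maximal ideal `m` of `A` can be extended by an
element of `m`. -/
lemma IsCohenMacaulayRing.exists_isSMulRegular_of_length_lt_height [IsNoetherianRing A]
    [Algebra.IsIntegral A B] [Algebra.HasGoingDown A B] (hB : IsCohenMacaulayRing B)
    (m : Ideal A) [hm : m.IsMaximal] (rs : List B)
    (reg : IsWeaklyRegular B rs)
    (hlt : (rs.length : ℕ∞) < m.height) :
    ∃ f ∈ m, IsSMulRegular (B ⧸ (Ideal.ofList rs • ⊤ : Submodule B B)) (algebraMap A B f) := by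
  have := hB.isNoetherianRing
  set M := B ⧸ (Ideal.ofList rs • ⊤ : Submodule B B)
  by_contra! hcon
  have hfin : (associatedPrimes B M).Finite := associatedPrimes.finite B M
  -- If every element of `m` is a zero divisor, prime avoidance puts `m` under one associated prime
  -- q. Integrality makes q maximal and going-down gives ht m ≤ ht q = depth B_q, contradicting the
  -- depth lemma at q.
  have hsub : (m : Set A) ⊆ ⋃ q ∈ (hfin.toFinset : Set (Ideal B)),
      (q.comap (algebraMap A B) : Set A) := by
    intro f hf
    have hf' := hcon f hf
    rw [isSMulRegular_iff_right_eq_zero_of_smul] at hf'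
    push Not at hf'
    obtain ⟨x, hx, hx0⟩ := hf'
    have hmem : algebraMap A B f ∈ ⋃ p ∈ associatedPrimes B M, (p : Set B) := by
      rw [biUnion_associatedPrimes_eq_zero_divisors]
      exact ⟨x, hx0, hx⟩
    simpa using hmem
  obtain ⟨q, hq, hmq⟩ := (Ideal.subset_union_prime ⊥ ⊥ (fun q hq _ _ ↦ by
    have : q.IsPrime := (hfin.mem_toFinset.mp hq).isPrime
    exact Ideal.comap_isPrime _ _)).mp hsub
  replace hq := hfin.mem_toFinset.mp hq
  have hqp : q.IsPrime := hq.isPrime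
  have hqm : m = q.comap (algebraMap A B) := hm.eq_of_le (Ideal.comap_isPrime _ _).ne_top hmq
  have hqmax : q.IsMaximal := Ideal.isMaximal_of_isIntegral_of_isMaximal_comap q (hqm ▸ hm)
  have : q.LiesOver m := ⟨hqm⟩
  have hht : m.height ≤ q.height := by
    rw [Ideal.height_eq_height_add_of_liesOver_of_hasGoingDown m q]
    exact le_self_add
  have hCM := hB.localization_maximal q
  have := hCM.isNoetherianRing
  let Bq := Localization.AtPrime q
  have hdepth : localRingDepth Bq = q.height := by
    have := hCM.depth_eq_dim
    rw [IsLocalization.AtPrime.ringKrullDim_eq_height q] at this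
    exact_mod_cast this
  refine maximalIdeal_notMem_associatedPrimes_of_length_lt_depth
    (rs.map (algebraMap B Bq)) (reg.of_isLocalization Bq q.primeCompl) ?_ ?_
  · rw [List.length_map, hdepth]
    exact hlt.trans_le hht
  · obtain ⟨-, x, hx⟩ := isAssociatedPrime_iff.mp hq
    obtain ⟨x, rfl⟩ := Submodule.Quotient.mk_surjective _ x
    have hcol (b : B) : b ∈ q ↔ b * x ∈ Ideal.ofList rs := by
      rw [hx, Submodule.mem_colon_singleton, Submodule.mem_bot, ← Submodule.Quotient.mk_smul,
        Submodule.Quotient.mk_eq_zero]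
      simp
    refine isAssociatedPrime_iff.mpr ⟨inferInstance,
      Submodule.Quotient.mk (algebraMap B Bq x), ?_⟩
    refine (IsLocalRing.maximalIdeal.isMaximal Bq).eq_of_le ?_ ?_
    · rw [Ne, Ideal.eq_top_iff_one, Submodule.mem_colon_singleton, Submodule.mem_bot, one_smul,
        Submodule.Quotient.mk_eq_zero, ← Ideal.map_ofList, smul_eq_mul, Ideal.mul_top,
        IsLocalization.algebraMap_mem_map_algebraMap_iff q.primeCompl]
      rintro ⟨s, hs, hsx⟩
      exact hs ((hcol s).mpr hsx)
    · rw [← Localization.AtPrime.map_eq_maximalIdeal, Ideal.map_le_iff_le_comap]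
      intro b hb
      rw [Ideal.mem_comap, Submodule.mem_colon_singleton, Submodule.mem_bot,
        ← Submodule.Quotient.mk_smul, Submodule.Quotient.mk_eq_zero, ← Ideal.map_ofList,
        smul_eq_mul, smul_eq_mul, Ideal.mul_top, ← map_mul]
      exact Ideal.mem_map_of_mem _ ((hcol b).mp hb)

/-- The Cohen-Macaulay property descends along an integral algebra with going-down which has a
linear retraction. -/
theorem IsCohenMacaulayRing.of_retraction [IsNoetherianRing A] [Algebra.IsIntegral A B]
    [Algebra.HasGoingDown A B] (hB : IsCohenMacaulayRing B) (ρ : B →ₗ[A] A) (hρ : ρ 1 = 1) :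
    IsCohenMacaulayRing A := by
  refine ⟨inferInstance, fun m hm ↦ ⟨inferInstance, ?_⟩⟩
  have hreg (n : ℕ) (hn : (n : ℕ∞) ≤ m.height) :
      ∃ rs : List A, rs.length = n ∧ (∀ r ∈ rs, r ∈ m) ∧ IsWeaklyRegular B rs := by
    induction n with
    | zero => exact ⟨[], by simp⟩
    | succ n ih =>
      have hn' : (n : ℕ∞) < m.height := lt_of_lt_of_le (by exact_mod_cast n.lt_succ_self) hn
      obtain ⟨rs, hlen, hmem, reg⟩ := ih hn'.le
      have reg' := (isWeaklyRegular_map_algebraMap_iff B B rs).mpr reg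
      obtain ⟨f, hf, hfreg⟩ := hB.exists_isSMulRegular_of_length_lt_height m
        (rs.map (algebraMap A B)) reg' (by simpa [hlen] using hn')
      refine ⟨rs ++ [f], by simp [hlen], ?_, ?_⟩
      · simpa [or_imp, forall_and] using ⟨hmem, hf⟩
      · rw [← isWeaklyRegular_map_algebraMap_iff B B, List.map_append, List.map_singleton,
          isWeaklyRegular_append_iff, isWeaklyRegular_singleton_iff]
        exact ⟨reg', hfreg⟩
  have hdim : ringKrullDim (Localization.AtPrime m) = m.height :=
    IsLocalization.AtPrime.ringKrullDim_eq_height m _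
  rw [hdim]
  norm_cast
  refine le_antisymm ?_ ?_
  · refine iSup_le fun rs ↦ iSup_le fun hrs ↦ iSup_le fun _ ↦ ?_
    have h := ringKrullDim_add_length_eq_ringKrullDim_of_isRegular rs hrs
    rw [hdim] at h
    have : Nontrivial (Localization.AtPrime m ⧸ Ideal.ofList rs) := by
      refine Ideal.Quotient.nontrivial_iff.mpr fun htop ↦ hrs.top_ne_smul ?_
      simp [htop]
    have h0 : 0 ≤ ringKrullDim (Localization.AtPrime m ⧸ Ideal.ofList rs) :=
      ringKrullDim_nonneg_of_nontrivial
    have : ((rs.length : ℕ∞) : WithBot ℕ∞) ≤ (m.height : WithBot ℕ∞) := by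
      rw [← h]
      exact le_add_of_nonneg_left h0
    exact_mod_cast this
  · obtain ⟨d, hd⟩ := ENat.ne_top_iff_exists.mp (Ideal.height_ne_top (I := m) hm.ne_top)
    obtain ⟨rs, hlen, hmem, reg⟩ := hreg d hd.le
    -- A is a direct summand of B; properness of the ideal is recovered after localizing, since `rs`
    -- lies in `m`.
    have regA : IsWeaklyRegular A rs :=
      reg.of_leftInverse (Algebra.linearMap A B) ρ (LinearMap.ext_ring (by simpa using hρ))
    have regm := regA.isRegular_of_isLocalization_of_mem (Localization.AtPrime m) m hmem
    rw [← hd, ← hlen, ← List.length_map (algebraMap A (Localization.AtPrime m))]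
    refine le_iSup_of_le _ (le_iSup_of_le regm (le_iSup_of_le ?_ le_rfl))
    simp only [List.mem_map, forall_exists_index, and_imp]
    rintro _ r hr rfl
    exact (IsLocalization.AtPrime.to_map_mem_maximal_iff _ m r).mpr (hmem r hr)

/-- `H` ensures that the prime of B supplied by going-down contains I, hence survives in B/I. -/
lemma Algebra.HasGoingDown.quotient [Algebra.HasGoingDown A B] (J : Ideal A) (I : Ideal B)
    [Algebra (A ⧸ J) (B ⧸ I)]
    (hcomm : ∀ x : A, algebraMap (A ⧸ J) (B ⧸ I) (Ideal.Quotient.mk J x) =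
      Ideal.Quotient.mk I (algebraMap A B x))
    (H : ∀ P : Ideal B, P.IsPrime → J ≤ P.under A → I ≤ P) :
    Algebra.HasGoingDown (A ⧸ J) (B ⧸ I) := by
  refine ⟨fun {p} _ Q _ hlt ↦ ?_⟩
  have : (Q.comap (Ideal.Quotient.mk I)).LiesOver
      ((Q.under (A ⧸ J)).comap (Ideal.Quotient.mk J)) :=
    ⟨by ext x; simp [Ideal.under, Ideal.mem_comap, hcomm]⟩
  obtain ⟨P, hPQ, hP, hPp⟩ := Ideal.exists_ideal_le_liesOver_of_le
    (p := p.comap (Ideal.Quotient.mk J)) (Q.comap (Ideal.Quotient.mk I))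
    (Ideal.comap_mono (f := Ideal.Quotient.mk J) hlt.le)
  have hmemP (x : A) : Ideal.Quotient.mk J x ∈ p ↔ algebraMap A B x ∈ P := by
    rw [← Ideal.mem_comap, hPp.over]; rfl
  have hIP : I ≤ P := H P hP fun x hx ↦ by
    rw [Ideal.under, Ideal.mem_comap, ← hmemP, Ideal.Quotient.eq_zero_iff_mem.mpr hx]
    exact p.zero_mem
  have hker : RingHom.ker (Ideal.Quotient.mk I) ≤ P := by rwa [Ideal.mk_ker]
  refine ⟨P.map (Ideal.Quotient.mk I), ?_,
    Ideal.map_isPrime_of_surjective Ideal.Quotient.mk_surjective hker, ⟨?_⟩⟩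
  · exact Ideal.map_le_iff_le_comap.mpr hPQ
  · ext x
    obtain ⟨x, rfl⟩ := Ideal.Quotient.mk_surjective x
    rw [hmemP, Ideal.under, Ideal.mem_comap, hcomm, ← Ideal.mem_comap (f := Ideal.Quotient.mk I),
      Ideal.comap_map_of_surjective' _ Ideal.Quotient.mk_surjective, Ideal.mk_ker,
      sup_eq_left.mpr hIP]

end Retract

/-! ### Monomial ideals, their radicals, and the substitution x_i ↦ x_i^N. -/

section Monomial

variable {σ k : Type*} [Field k]

lemma IsMonomialIdeal.monomial_mem_of_mem_support {I : Ideal (MvPolynomial σ k)}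
    (hI : IsMonomialIdeal I) {f : MvPolynomial σ k} (hf : f ∈ I) {a : σ →₀ ℕ}
    (ha : a ∈ f.support) : monomial a (1 : k) ∈ I := by
  obtain ⟨S, rfl⟩ := hI
  rw [mem_ideal_span_monomial_image] at hf ⊢
  intro b hb
  obtain rfl : b = a := by simpa using support_monomial_subset hb
  exact hf b ha

lemma MvPolynomial.monomial_mem_of_monomial_one_mem {I : Ideal (MvPolynomial σ k)} {a : σ →₀ ℕ}
    (h : monomial a (1 : k) ∈ I) (c : k) : monomial a c ∈ I := by
  have := I.mul_mem_left (C c) h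
  rwa [C_mul_monomial, mul_one] at this

/-- The radical of a monomial ideal contains all monomials of its elements. -/
lemma IsMonomialIdeal.monomial_mem_radical_of_mem_support [LinearOrder σ] [WellFoundedGT σ]
    {I : Ideal (MvPolynomial σ k)} (hI : IsMonomialIdeal I) {f : MvPolynomial σ k}
    (hf : f ∈ I.radical) {a : σ →₀ ℕ} (ha : a ∈ f.support) :
    monomial a (1 : k) ∈ I.radical := by
  classical
  induction hn : f.support.card using Nat.strong_induction_on generalizing f with
  | _ n ih =>
    -- The leading monomial of a power cannot cancel, so that of `f` lies in the radical; subtract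
    -- the leading term and induct on the number of terms.
    let m : MonomialOrder σ := MonomialOrder.lex
    have hf0 : f ≠ 0 := by rintro rfl; simp at ha
    have hlead : monomial (m.degree f) (1 : k) ∈ I.radical := by
      obtain ⟨N, hN⟩ := hf
      refine ⟨N, ?_⟩
      rw [monomial_pow, one_pow]
      refine hI.monomial_mem_of_mem_support hN ?_
      rw [mem_support_iff, m.coeff_pow_nsmul_degree]
      exact pow_ne_zero _ (m.leadingCoeff_ne_zero_iff.mpr hf0)
    by_cases had : a = m.degree f
    · rwa [had]
    have hcoeff (b : σ →₀ ℕ) : (f - m.leadingTerm f).coeff b =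
        if b = m.degree f then 0 else f.coeff b := by
      rw [coeff_sub, MonomialOrder.leadingTerm, coeff_monomial]
      split_ifs with h1 h2 h2
      · subst h2; simp [MonomialOrder.leadingCoeff]
      · exact absurd h1.symm h2
      · exact absurd h2.symm h1
      · simp
    refine ih _ ?_ (f := f - m.leadingTerm f) (sub_mem hf ?_) ?_ rfl
    · rw [← hn]
      refine Finset.card_lt_card ⟨fun b hb ↦ ?_, fun h ↦ ?_⟩
      · rw [mem_support_iff, hcoeff] at hb
        rw [mem_support_iff]
        intro h0
        simp [h0] at hb
      · have := h (m.degree_mem_support hf0)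
        rw [mem_support_iff, hcoeff] at this
        simp at this
    · exact monomial_mem_of_monomial_one_mem hlead _
    · rw [mem_support_iff, hcoeff, if_neg had]
      exact mem_support_iff.mp ha

variable (σ k) in
/-- The `k`-linear map sending `x ^ (N • a)` to `x ^ a` and all other monomials to zero. -/
noncomputable def MvPolynomial.contractMonomials (N : ℕ) :
    MvPolynomial σ k →ₗ[k] MvPolynomial σ k :=
  open Classical in
  (basisMonomials σ k).constr k fun a ↦
    if ∀ i, N ∣ a i then monomial (a.mapRange (· / N) (Nat.zero_div N)) 1 else 0

open Classical in
lemma MvPolynomial.contractMonomials_monomial (N : ℕ) (a : σ →₀ ℕ) (c : k) :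
    contractMonomials σ k N (monomial a c) =
      if ∀ i, N ∣ a i then monomial (a.mapRange (· / N) (Nat.zero_div N)) c else 0 := by
  have h : monomial a c = c • basisMonomials σ k a := by simp [smul_monomial]
  rw [h, map_smul, contractMonomials, Module.Basis.constr_basis]
  split_ifs <;> simp [smul_monomial]

/-- This projection formula becomes the A-linearity of the retraction. -/
lemma MvPolynomial.contractMonomials_expand_mul {N : ℕ} (hN : 0 < N) (f g : MvPolynomial σ k) :
    contractMonomials σ k N (expand N f * g) = f * contractMonomials σ k N g := by
  classical
  induction f using MvPolynomial.induction_on' with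
  | add p q hp hq => simp only [map_add, add_mul, hp, hq]
  | monomial b d =>
    induction g using MvPolynomial.induction_on' with
    | add p q hp hq => simp only [map_add, mul_add, hp, hq]
    | monomial a c =>
      rw [expand_monomial, monomial_mul, contractMonomials_monomial, contractMonomials_monomial]
      have h (i : σ) : N ∣ (N • b + a) i ↔ N ∣ a i := by
        simp [Nat.dvd_add_right (Nat.dvd_mul_right N (b i))]
      simp only [h]
      split_ifs
      · rw [monomial_mul]
        congr 2
        ext i
        simp [Nat.mul_add_div hN]
      · simp

lemma MvPolynomial.contractMonomials_one (N : ℕ) :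
    contractMonomials σ k N 1 = 1 := by
  classical
  have h : (1 : MvPolynomial σ k) = monomial 0 1 := rfl
  rw [h, contractMonomials_monomial]
  simp

lemma IsMonomialIdeal.contractMonomials_mem_radical {I : Ideal (MvPolynomial σ k)}
    (hI : IsMonomialIdeal I) (N : ℕ) {f : MvPolynomial σ k} (hf : f ∈ I) :
    contractMonomials σ k N f ∈ I.radical := by
  classical
  rw [f.as_sum, map_sum]
  refine Ideal.sum_mem _ fun a ha ↦ ?_
  rw [contractMonomials_monomial]
  split_ifs with h
  · refine monomial_mem_of_monomial_one_mem (Ideal.mem_radical_iff.mpr ⟨N, ?_⟩) _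
    rw [monomial_pow, one_pow]
    convert hI.monomial_mem_of_mem_support hf ha
    ext i
    simp [Nat.mul_div_cancel' (h i)]
  · exact zero_mem _

lemma MvPolynomial.isIntegral_expand {N : ℕ} (hN : 0 < N) :
    (expand N : MvPolynomial σ k →ₐ[k] MvPolynomial σ k).toRingHom.IsIntegral := by
  let : Algebra (MvPolynomial σ k) (MvPolynomial σ k) := (expand N).toRingHom.toAlgebra
  intro f
  change IsIntegral _ f
  induction f using MvPolynomial.induction_on with
  | C a =>
    rw [← expand_C N a]
    exact isIntegral_algebraMap (R := MvPolynomial σ k) (A := MvPolynomial σ k) (x := C a)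
  | add p q hp hq => exact hp.add hq
  | mul_X p i hp =>
    refine hp.mul (IsIntegral.of_pow hN ?_)
    rw [← expand_X N i]
    exact isIntegral_algebraMap (R := MvPolynomial σ k) (A := MvPolynomial σ k) (x := X i)

lemma IsMonomialIdeal.exists_pos_expand_mem [LinearOrder σ] [Finite σ]
    {I : Ideal (MvPolynomial σ k)} (hI : IsMonomialIdeal I) :
    ∃ N : ℕ, 0 < N ∧ ∀ f ∈ I.radical, expand N f ∈ I := by
  obtain ⟨N, hN⟩ := I.exists_radical_pow_le_of_fg (IsNoetherian.noetherian _)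
  -- The nilpotency exponent may be 0 when I is the unit ideal, hence the shift.
  refine ⟨N + 1, N.succ_pos, fun f hf ↦ ?_⟩
  rw [f.as_sum, map_sum]
  refine Ideal.sum_mem _ fun a ha ↦ ?_
  rw [expand_monomial]
  refine monomial_mem_of_monomial_one_mem ?_ _
  have h := Ideal.pow_mem_pow (hI.monomial_mem_radical_of_mem_support hf ha) (N + 1)
  rw [monomial_pow, one_pow] at h
  exact hN (Ideal.pow_le_pow_right N.le_succ h)

end Monomial

theorem proposition3p1 {k : Type*} [Field k] (r : ℕ) (I : Ideal (MvPolynomial (Fin r) k))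
    (hI : IsMonomialIdeal I) (hCM : IsCohenMacaulayRing (MvPolynomial (Fin r) k ⧸ I)) :
    IsCohenMacaulayRing (MvPolynomial (Fin r) k ⧸ I.radical) := by
  obtain ⟨N, hN, hexp⟩ := hI.exists_pos_expand_mem
  let φ : MvPolynomial (Fin r) k →+* MvPolynomial (Fin r) k := (expand N).toRingHom
  let : Algebra (MvPolynomial (Fin r) k ⧸ I.radical) (MvPolynomial (Fin r) k ⧸ I) :=
    (Ideal.quotientMap (I := I.radical) I φ hexp).toAlgebra
  have hcomm (x : MvPolynomial (Fin r) k) :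
      algebraMap (MvPolynomial (Fin r) k ⧸ I.radical) (MvPolynomial (Fin r) k ⧸ I)
        (Ideal.Quotient.mk _ x) = Ideal.Quotient.mk I (expand N x) :=
    Ideal.quotientMap_mk
  have : Algebra.IsIntegral (MvPolynomial (Fin r) k ⧸ I.radical) (MvPolynomial (Fin r) k ⧸ I) :=
    ⟨RingHom.IsIntegral.tower_top (Ideal.Quotient.mk I.radical) (algebraMap _ _)
      ((isIntegral_expand hN).trans φ (Ideal.Quotient.mk I)
        (RingHom.isIntegral_of_surjective _ Ideal.Quotient.mk_surjective))⟩
  have : Algebra.HasGoingDown (MvPolynomial (Fin r) k ⧸ I.radical)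
      (MvPolynomial (Fin r) k ⧸ I) := by
    -- R is viewed as an algebra over itself via `expand N`: integral, injective, with normal base,
    -- hence going-down.
    let : Algebra (MvPolynomial (Fin r) k) (MvPolynomial (Fin r) k) := φ.toAlgebra
    have : Algebra.IsIntegral (MvPolynomial (Fin r) k) (MvPolynomial (Fin r) k) :=
      ⟨isIntegral_expand hN⟩
    have : @FaithfulSMul (MvPolynomial (Fin r) k) (MvPolynomial (Fin r) k) Algebra.toSMul :=
      (faithfulSMul_iff_algebraMap_injective _ _).mpr (expand_injective hN)
    refine Algebra.HasGoingDown.quotient I.radical I hcomm fun P hP hle f hf ↦ ?_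
    rw [f.as_sum]
    refine Ideal.sum_mem _ fun a ha ↦ monomial_mem_of_monomial_one_mem ?_ _
    -- On a monomial `expand N` is the N-th power, so primality of P returns the monomial itself.
    have h : expand N (monomial a (1 : k)) ∈ P :=
      hle (I.le_radical (hI.monomial_mem_of_mem_support hf ha))
    rw [expand_monomial, ← one_pow N, ← monomial_pow] at h
    exact hP.mem_of_pow_mem _ h
  let ρ₀ : (MvPolynomial (Fin r) k ⧸ I) →ₗ[k] (MvPolynomial (Fin r) k ⧸ I.radical) :=
    Submodule.liftQ (I.restrictScalars k)
      ((Ideal.Quotient.mkₐ k I.radical).toLinearMap ∘ₗ contractMonomials (Fin r) k N)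
      (fun f hf ↦ Ideal.Quotient.eq_zero_iff_mem.mpr (hI.contractMonomials_mem_radical N hf)) ∘ₗ
    (Submodule.Quotient.restrictScalarsEquiv k I).symm.toLinearMap
  have hρ₀ (f : MvPolynomial (Fin r) k) : ρ₀ (Ideal.Quotient.mk I f) =
      Ideal.Quotient.mk I.radical (contractMonomials (Fin r) k N f) := rfl
  let ρ : (MvPolynomial (Fin r) k ⧸ I) →ₗ[MvPolynomial (Fin r) k ⧸ I.radical]
      (MvPolynomial (Fin r) k ⧸ I.radical) :=
    { toFun := ρ₀
      map_add' := map_add ρ₀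
      map_smul' := fun x y ↦ by
        obtain ⟨x, rfl⟩ := Ideal.Quotient.mk_surjective x
        obtain ⟨y, rfl⟩ := Ideal.Quotient.mk_surjective y
        rw [Algebra.smul_def, hcomm, ← map_mul, hρ₀, hρ₀, contractMonomials_expand_mul hN, map_mul]
        rfl }
  refine hCM.of_retraction ρ ?_
  change ρ₀ (Ideal.Quotient.mk I 1) = 1
  rw [hρ₀, contractMonomials_one, map_one]
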